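/- For a finite graph $G$ and an integer $t\ge 2$, a $t$-clique cover of $G$ is a collection of cliques of $G$ such that every clique of $G$ on $t$ vertices is contained in some member of the collection; let $C_t(G)$ denote the minimum number of cliques in a $t$-clique cover of $G$. A fractional $t$-clique cover of $G$ is an assignment $f$ of nonnegative real weights to the cliques of $G$ such that $\sum_{K\supseteq T} f(K)\ge 1$ for every clique $T$ of $G$ on $t$ vertices, where the sum is over all cliques $K$ of $G$ containing $T$; let $C_t^*(G)$ denote the minimum of the total weight $\sum_K f(K)$ over all fractional $t$-clique covers $f$ of $G$. **Theorem.** For every integer $t\ge 2$ there is a constant $c=c(t)>0$ such that for every integer $n$ with $n\ge e^4+t$ and $n\ge 2t+3$ there exists a graph $G_n$ on $n$ vertices with $$ C_t(G_n)-C_t^*(G_n) \;>\; \frac{c\,\log\log n}{(\log n)^{8\sqrt{\log n/\log\log n}}}\; n^2 \;=\; n^{2-o(1)}, $$ where $\log$ is the natural logarithm and, for fixed $t$, the term $o(1)$ tends to $0$ as $n\to\infty$. -/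

import Mathlib

open Filter Topology

namespace CliqueCover

variable {V : Type*} [Fintype V]

open Classical in
/-- The finite set of all cliques of `G`, each given by its vertex set. -/
noncomputable def cliques (G : SimpleGraph V) : Finset (Finset V) :=
  {K : Finset V | G.IsClique (K : Set V)}

/-- A collection `F` of cliques of `G` is a `t`-clique cover if every `t`-clique of `G`
is contained in some member of `F`. -/
def IsCover (G : SimpleGraph V) (t : ℕ) (F : Finset (Finset V)) : Prop :=
  F ⊆ cliques G ∧ ∀ T : Finset V, G.IsNClique t T → ∃ K ∈ F, T ⊆ K

/-- The `t`-clique cover number: the least number of cliques in a `t`-clique cover. -/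
noncomputable def coverNum (G : SimpleGraph V) (t : ℕ) : ℕ :=
  sInf {m : ℕ | ∃ F : Finset (Finset V), IsCover G t F ∧ F.card = m}

open Classical in
/-- A fractional `t`-clique cover: nonnegative real weights on the cliques of `G` such that every
`t`-clique `T` has total weight at least one on the cliques containing it.
(Values of `f` outside `cliques G` are irrelevant.) -/
def IsFracCover (G : SimpleGraph V) (t : ℕ) (f : Finset V → ℝ) : Prop :=
  (∀ K ∈ cliques G, 0 ≤ f K) ∧
    ∀ T : Finset V, G.IsNClique t T → 1 ≤ ∑ K ∈ cliques G with T ⊆ K, f K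

/-- The fractional `t`-clique cover number: the least total weight of a fractional
`t`-clique cover. -/
noncomputable def fracCoverNum (G : SimpleGraph V) (t : ℕ) : ℝ :=
  sInf {w : ℝ | ∃ f : Finset V → ℝ, IsFracCover G t f ∧ ∑ K ∈ cliques G, f K = w}

theorem isCover_cliques (G : SimpleGraph V) (t : ℕ) : IsCover G t (cliques G) :=
  ⟨subset_rfl, fun T hT => ⟨T, by simpa [cliques] using hT.isClique, subset_rfl⟩⟩

/-- The cover number is attained. -/
theorem exists_isCover_card_eq (G : SimpleGraph V) (t : ℕ) :
    ∃ F : Finset (Finset V), IsCover G t F ∧ F.card = coverNum G t :=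
  Nat.sInf_mem (s := {m : ℕ | ∃ F : Finset (Finset V), IsCover G t F ∧ F.card = m})
    ⟨_, _, isCover_cliques G t, rfl⟩

/-- The total weights of fractional covers are bounded below. -/
theorem bddBelow_fracCover (G : SimpleGraph V) (t : ℕ) :
    BddBelow {w : ℝ | ∃ f : Finset V → ℝ, IsFracCover G t f ∧ ∑ K ∈ cliques G, f K = w} := by
  refine ⟨0, ?_⟩
  rintro w ⟨f, hf, rfl⟩
  exact Finset.sum_nonneg hf.1

open Classical in
/-- The indicator function of a cover is a fractional cover. -/
theorem IsCover.isFracCover {G : SimpleGraph V} {t : ℕ} {F : Finset (Finset V)}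
    (hF : IsCover G t F) : IsFracCover G t (fun K => if K ∈ F then 1 else 0) := by
  refine ⟨fun K _ => by positivity, fun T hT => ?_⟩
  obtain ⟨K, hK, hTK⟩ := hF.2 T hT
  have := Finset.single_le_sum (s := {K ∈ cliques G | T ⊆ K})
    (f := fun K => if K ∈ F then (1 : ℝ) else 0) (fun _ _ => by positivity)
    (Finset.mem_filter.2 ⟨hF.1 hK, hTK⟩)
  simpa [hK] using this

/-- The fractional cover number is at most the cover number. -/
theorem fracCoverNum_le (G : SimpleGraph V) (t : ℕ) : fracCoverNum G t ≤ coverNum G t := by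
  classical
  obtain ⟨F, hF, hc⟩ := exists_isCover_card_eq G t
  refine csInf_le (bddBelow_fracCover G t) ⟨_, hF.isFracCover, ?_⟩
  rw [← hc, Finset.sum_ite_mem, Finset.inter_eq_right.2 hF.1]
  simp

end CliqueCover

/-! Put `t = r + 1` and let `H` be the join of a pentagon with `r` nonadjacent pairs, on `2 * t + 3`
vertices. Every `t`-clique of `H` lies in two of its `5 * 2 ^ r` facets, so weight `1/2` on each
facet is a fractional cover of weight `(5/2) * 2 ^ r`. An integral cover needs `3 * 2 ^ r` cliques:
for each choice of one vertex per pair, a clique covers at most two of the five ridges, and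
different choices share no clique. One copy of `H` thus has gap at least `2 ^ r / 2 ≥ 1`.

The gap adds up over copies if every clique of the union with at least two vertices lies in a single
copy, which `IsPacking` guarantees. As in Behrend's construction, copies are indexed by a translate
`x` and a sphere point `a`, vertex `u` going to `(u, x + c u * a)`; strict convexity of the sphere
excludes triangles with edges from different copies (`isPacking_spherePoint`).

Dimension about `√(log n)` gives `n ^ 2 / exp (O(√(log n)))` copies, more than required for large
`n` (`eventually_exists_parameters`). For the remaining `n`, one copy suffices after shrinking `c`.
-/

namespace CliqueCover

/-! ### The gadget: a pentagon joined with nonadjacent pairs -/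

/-- The vertices of the join of a pentagon with `r` pairs of nonadjacent vertices. -/
abbrev PentVertex (r : ℕ) : Type := Fin 5 ⊕ (Fin r × Bool)

/-- The join of a pentagon with `r` pairs of nonadjacent vertices. -/
def pentJoin (r : ℕ) : SimpleGraph (PentVertex r) where
  Adj
    | .inl a, .inl b => a = b + 1 ∨ b = a + 1
    | .inl _, .inr _ => True
    | .inr _, .inl _ => True
    | .inr p, .inr q => p.1 ≠ q.1
  symm := ⟨by
    rintro (a | p) (b | q) h
    · exact h.symm
    · trivial
    · trivial
    · exact Ne.symm h⟩
  loopless := ⟨by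
    rintro (a | p) h
    · have : ∀ a : Fin 5, ¬(a = a + 1 ∨ a = a + 1) := by decide
      exact this a h
    · exact h rfl⟩

theorem pentJoin_adj_inl {r : ℕ} {a b : Fin 5} :
    (pentJoin r).Adj (.inl a) (.inl b) ↔ a = b + 1 ∨ b = a + 1 := Iff.rfl

theorem pentJoin_adj_inr {r : ℕ} {p q : Fin r × Bool} :
    (pentJoin r).Adj (.inr p) (.inr q) ↔ p.1 ≠ q.1 := Iff.rfl

/-- The clique formed by one pentagon vertex and one vertex of each pair. -/
def ridge {r : ℕ} (s : Fin r → Bool) (z : Fin 5) : Finset (PentVertex r) :=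
  insert (.inl z) (Finset.univ.image fun j => .inr (j, s j))

/-- The clique formed by one pentagon edge and one vertex of each pair. -/
def facet {r : ℕ} (s : Fin r → Bool) (z : Fin 5) : Finset (PentVertex r) :=
  insert (.inl (z + 1)) (ridge s z)

theorem inl_mem_ridge {r : ℕ} {s : Fin r → Bool} {z a : Fin 5} :
    .inl a ∈ ridge s z ↔ a = z := by simp [ridge]

theorem inr_mem_ridge {r : ℕ} {s : Fin r → Bool} {z : Fin 5} {p : Fin r × Bool} :
    .inr p ∈ ridge s z ↔ p.2 = s p.1 := by
  obtain ⟨j, b⟩ := p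
  simp [ridge, eq_comm]

theorem inl_mem_facet {r : ℕ} {s : Fin r → Bool} {z a : Fin 5} :
    .inl a ∈ facet s z ↔ a = z + 1 ∨ a = z := by simp [facet, inl_mem_ridge]

theorem inr_mem_facet {r : ℕ} {s : Fin r → Bool} {z : Fin 5} {p : Fin r × Bool} :
    .inr p ∈ facet s z ↔ p.2 = s p.1 := by simp [facet, inr_mem_ridge]

theorem card_ridge {r : ℕ} (s : Fin r → Bool) (z : Fin 5) : (ridge s z).card = r + 1 := by
  rw [ridge, Finset.card_insert_of_notMem (by simp), Finset.card_image_of_injective, Finset.card_fin]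
  intro i j h
  simpa using congrArg (fun v => v.elim (fun _ => i) Prod.fst) h

theorem isClique_facet {r : ℕ} (s : Fin r → Bool) (z : Fin 5) :
    (pentJoin r).IsClique (facet s z : Set (PentVertex r)) := by
  rintro (a | p) ha (b | q) hb hab
  · rw [Finset.mem_coe, inl_mem_facet] at ha hb
    rw [pentJoin_adj_inl]
    rcases ha with rfl | rfl <;> rcases hb with rfl | rfl <;> simp at hab ⊢
  · trivial
  · trivial
  · rw [Finset.mem_coe, inr_mem_facet] at ha hb
    rw [pentJoin_adj_inr]
    intro h
    exact hab (congrArg _ (Prod.ext h (by rw [ha, hb, h])))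

theorem ridge_subset_facet {r : ℕ} (s : Fin r → Bool) (z : Fin 5) : ridge s z ⊆ facet s z :=
  Finset.subset_insert _ _

theorem isClique_ridge {r : ℕ} (s : Fin r → Bool) (z : Fin 5) :
    (pentJoin r).IsClique (ridge s z : Set (PentVertex r)) :=
  (isClique_facet s z).subset (by exact_mod_cast ridge_subset_facet s z)

/-- A set of pairwise equal or adjacent vertices of a pentagon has at most two elements. -/
theorem card_le_two_of_pentagon_clique : ∀ S : Finset (Fin 5),
    (∀ a ∈ S, ∀ b ∈ S, a = b ∨ a = b + 1 ∨ b = a + 1) → S.card ≤ 2 := by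
  decide

/-- A set of pairwise equal or adjacent vertices of a pentagon lies in an edge. -/
theorem pentagon_clique_cases : ∀ S : Finset (Fin 5),
    (∀ a ∈ S, ∀ b ∈ S, a = b ∨ a = b + 1 ∨ b = a + 1) →
      S = ∅ ∨ (∃ z, S = {z}) ∨ ∃ z, S = {z, z + 1} := by
  decide

/-- Every clique on `r + 1` vertices lies in two different facets. -/
theorem exists_two_facets {r : ℕ} {S : Finset (PentVertex r)}
    (hS : (pentJoin r).IsNClique (r + 1) S) :
    ∃ s z s' z', facet s z ≠ facet s' z' ∧ S ⊆ facet s z ∧ S ⊆ facet s' z' := by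
  classical
  obtain ⟨hcl, hcard⟩ := hS
  set A := S.toLeft with hA
  set B := S.toRight with hB
  have hcardAB : A.card + B.card = r + 1 := by rw [← hcard]; exact Finset.card_toLeft_add_card_toRight
  have hAcl : ∀ a ∈ A, ∀ b ∈ A, a = b ∨ a = b + 1 ∨ b = a + 1 := by
    intro a ha b hb
    rw [hA, Finset.mem_toLeft] at ha hb
    by_cases h : a = b
    · exact .inl h
    · exact .inr (hcl ha hb (by simpa using h))
  have hBinj : Set.InjOn (Prod.fst : Fin r × Bool → Fin r) B := by
    intro p hp q hq h
    rw [Finset.mem_coe, hB, Finset.mem_toRight] at hp hq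
    by_contra hpq
    exact (hcl hp hq (by simpa using hpq)) h
  -- Pairs that miss `B` get the default `false`.
  set s : Fin r → Bool := fun j => decide ((j, true) ∈ B) with hs
  have hsB : ∀ p ∈ B, p.2 = s p.1 := by
    rintro ⟨j, b⟩ hp
    cases b
    · have : (j, true) ∉ B := fun h => by
        have := hBinj (Finset.mem_coe.2 hp) (Finset.mem_coe.2 h) rfl
        simp at this
      simp [hs, this]
    · simp [hs, hp]
  have hBimg : (B.image Prod.fst).card = B.card := Finset.card_image_of_injOn hBinj
  have hBle : B.card ≤ r := by
    rw [← hBimg]; simpa using Finset.card_le_univ (B.image Prod.fst)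
  have hsub : ∀ (s' : Fin r → Bool) (z : Fin 5), (∀ p ∈ B, p.2 = s' p.1) →
      (∀ a ∈ A, a = z + 1 ∨ a = z) → S ⊆ facet s' z := by
    rintro s' z h1 h2 (a | p) h
    · exact inl_mem_facet.2 (h2 a (Finset.mem_toLeft.2 h))
    · exact inr_mem_facet.2 (h1 p (Finset.mem_toRight.2 h))
  rcases pentagon_clique_cases A hAcl with h | ⟨z, h⟩ | ⟨z, h⟩
  · rw [h, Finset.card_empty] at hcardAB
    omega
  -- A single pentagon vertex lies on two pentagon edges.
  · refine ⟨s, z, s, z - 1, fun he => ?_, hsub s z hsB ?_, hsub s (z - 1) hsB ?_⟩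
    · have : (Sum.inl (z + 1) : PentVertex r) ∈ facet s (z - 1) := he ▸ inl_mem_facet.2 (.inl rfl)
      rw [inl_mem_facet] at this
      have hz : ∀ z : Fin 5, ¬(z + 1 = z - 1 + 1 ∨ z + 1 = z - 1) := by decide
      exact hz z this
    · simp [h]
    · simp [h]
  -- With a full pentagon edge only `r - 1` vertices remain, so some pair is missed and either of
  -- its vertices may be added.
  · have hA2 : A.card = 2 := by rw [h, Finset.card_pair]; simp
    obtain ⟨j, hj⟩ : ∃ j, j ∉ B.image Prod.fst := by
      by_contra! hall
      have : (B.image Prod.fst) = Finset.univ := Finset.eq_univ_of_forall hall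
      rw [this, Finset.card_fin] at hBimg
      omega
    have hup : ∀ b, ∀ p ∈ B, p.2 = Function.update s j b p.1 := by
      intro b p hp
      rw [Function.update_of_ne]
      · exact hsB p hp
      · rintro rfl
        exact hj (Finset.mem_image_of_mem _ hp)
    have hz : ∀ a ∈ A, a = z + 1 ∨ a = z := by simp [h]
    refine ⟨Function.update s j true, z, Function.update s j false, z, fun he => ?_,
      hsub _ z (hup _) hz, hsub _ z (hup _) hz⟩
    have : (Sum.inr (j, true) : PentVertex r) ∈ facet (Function.update s j false) z :=
      he ▸ inr_mem_facet.2 (by simp)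
    rw [inr_mem_facet] at this
    simp at this

/-! ### Packings of copies and cliques of their union -/

section Packing

variable {I U V : Type*}

/-- A family of maps `φ i : U → V` with `U`-partite images, any two of which share at most one
vertex, and such that no triangle arises from three edges lying in different images. -/
structure IsPacking (φ : I → U → V) : Prop where
  eq_of_apply_eq : ∀ {i j u v}, φ i u = φ j v → u = v
  eq_of_pair : ∀ {i j u v}, u ≠ v → φ i u = φ j u → φ i v = φ j v → i = j
  eq_of_triangle : ∀ {i j k u v w}, u ≠ v → v ≠ w → u ≠ w →
    φ i u = φ k u → φ i v = φ j v → φ j w = φ k w → i = j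

/-- The union of the images of `H` under a family of maps. -/
def packGraph (H : SimpleGraph U) {φ : I → U → V} (hφ : IsPacking φ) : SimpleGraph V where
  Adj p q := ∃ i u v, H.Adj u v ∧ φ i u = p ∧ φ i v = q
  symm := ⟨fun _ _ ⟨i, u, v, h, hu, hv⟩ => ⟨i, v, u, h.symm, hv, hu⟩⟩
  loopless := ⟨fun _ ⟨_, _, _, h, hu, hv⟩ => h.ne (hφ.eq_of_apply_eq (hu.trans hv.symm))⟩

variable {H : SimpleGraph U} {φ : I → U → V} (hφ : IsPacking φ)

theorem IsPacking.injective (hφ : IsPacking φ) (i : I) : Function.Injective (φ i) :=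
  fun _ _ h => hφ.eq_of_apply_eq h

theorem packGraph_adj_apply {i : I} {u v : U} :
    (packGraph H hφ).Adj (φ i u) (φ i v) ↔ H.Adj u v := by
  refine ⟨?_, fun h => ⟨i, u, v, h, rfl, rfl⟩⟩
  rintro ⟨j, u', v', h, hu, hv⟩
  rwa [← hφ.eq_of_apply_eq hu, ← hφ.eq_of_apply_eq hv]

/-- A clique of the union with at least two vertices lies in a single copy. -/
theorem exists_subset_range {K : Set V} (hK : (packGraph H hφ).IsClique K) (hn : K.Nontrivial) :
    ∃ i, K ⊆ Set.range (φ i) := by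
  obtain ⟨p, hp, q, hq, hpq⟩ := hn
  obtain ⟨i, u, v, huv, rfl, rfl⟩ := hK hp hq hpq
  refine ⟨i, fun x hx => ?_⟩
  by_cases h1 : φ i u = x
  · exact ⟨u, h1⟩
  by_cases h2 : φ i v = x
  · exact ⟨v, h2⟩
  -- The edges from `x` to the two chosen vertices close a triangle, so the triangle condition puts
  -- `x` into copy `i`.
  obtain ⟨j, v', w, hvw, hjv, rfl⟩ := hK hq hx h2
  obtain rfl := hφ.eq_of_apply_eq hjv
  obtain ⟨k, u', w', huw, hku, hkw⟩ := hK hp hx h1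
  obtain rfl := hφ.eq_of_apply_eq hku
  obtain rfl := hφ.eq_of_apply_eq hkw
  obtain rfl := hφ.eq_of_triangle huv.ne hvw.ne huw.ne hku.symm hjv.symm hkw.symm
  exact ⟨_, rfl⟩

variable [DecidableEq V]

theorem isClique_image {i : I} {S : Finset U} :
    (packGraph H hφ).IsClique (S.image (φ i) : Set V) ↔ H.IsClique (S : Set U) := by
  constructor
  · intro h u hu v hv huv
    refine (packGraph_adj_apply hφ (i := i)).1 (h ?_ ?_ ((hφ.injective i).ne huv)) <;>
    exact_mod_cast Finset.mem_image_of_mem _ (by assumption)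
  · intro h p hp q hq hpq
    rw [Finset.mem_coe, Finset.mem_image] at hp hq
    obtain ⟨u, hu, rfl⟩ := hp
    obtain ⟨v, hv, rfl⟩ := hq
    exact (packGraph_adj_apply hφ).2 (h hu hv fun e => hpq (e ▸ rfl))

/-- A finite clique of the union with at least two vertices is the image of a clique. -/
theorem exists_eq_image {K : Finset V} (hK : (packGraph H hφ).IsClique (K : Set V))
    (hn : 1 < K.card) : ∃ i, ∃ S : Finset U, H.IsClique (S : Set U) ∧ S.card = K.card ∧
      S.image (φ i) = K := by
  obtain ⟨i, hi⟩ := exists_subset_range hφ hK (Finset.one_lt_card_iff_nontrivial.1 hn)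
  obtain ⟨S, hS⟩ : ∃ S : Finset U, S.image (φ i) = K := by
    obtain ⟨S, -, hS⟩ := Finset.subset_set_image_iff.1 (hi.trans_eq Set.image_univ.symm)
    exact ⟨S, hS⟩
  refine ⟨i, S, ?_, ?_, hS⟩
  · rw [← isClique_image hφ (i := i), hS]
    exact hK
  · rw [← hS, Finset.card_image_of_injective _ (hφ.injective i)]

/-- Images of large sets lying in a common clique come from the same copy. -/
theorem index_eq_of_image_subset {K : Finset V} (hK : (packGraph H hφ).IsClique (K : Set V))
    {i j : I} {S T : Finset U} (hS : 1 < S.card) (hT : 1 < T.card)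
    (hSK : S.image (φ i) ⊆ K) (hTK : T.image (φ j) ⊆ K) : i = j := by
  have hn : 1 < K.card := hS.trans_le <| by
    rw [← Finset.card_image_of_injective S (hφ.injective i)]
    exact Finset.card_le_card hSK
  obtain ⟨k, hk⟩ := exists_subset_range hφ hK (Finset.one_lt_card_iff_nontrivial.1 hn)
  have key : ∀ {i : I} {S : Finset U}, 1 < S.card → S.image (φ i) ⊆ K → i = k := by
    intro i S hS hSK
    obtain ⟨u, hu, v, hv, huv⟩ := Finset.one_lt_card.1 hS
    have hk' : ∀ u ∈ S, φ i u = φ k u := by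
      intro u hu
      obtain ⟨u', hu'⟩ := hk (hSK (Finset.mem_image_of_mem _ hu))
      rw [← hu', hφ.eq_of_apply_eq hu']
    exact hφ.eq_of_pair huv (hk' u hu) (hk' v hv)
  rw [key hS hSK, key hT hTK]

end Packing

/-! ### The gap of a packing -/

section Gap

variable {I V : Type*} [Fintype I] [Fintype V] {r : ℕ} {φ : I → PentVertex r → V}

/-- Half weight on every copy of a facet suffices, since a `t`-clique lies in one copy and in two
facets there. -/
theorem fracCoverNum_packGraph_le (hφ : IsPacking φ) (hr : 1 ≤ r) :
    fracCoverNum (packGraph (pentJoin r) hφ) (r + 1) ≤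
      5 / 2 * (Fintype.card I * 2 ^ r : ℕ) := by
  classical
  set G := packGraph (pentJoin r) hφ with hG
  let Q : I × (Fin r → Bool) × Fin 5 → Finset V := fun x => (facet x.2.1 x.2.2).image (φ x.1)
  set Q' : Finset (Finset V) := Finset.univ.image Q with hQ'
  have hQcl : ∀ x, Q x ∈ cliques G := fun x => by
    rw [cliques, Finset.mem_filter_univ]
    exact (isClique_image hφ).2 (isClique_facet x.2.1 x.2.2)
  let f : Finset V → ℝ := fun K => if K ∈ Q' then 1 / 2 else 0
  have hf0 : ∀ K, 0 ≤ f K := fun K => by dsimp only [f]; positivity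
  have hf : IsFracCover G (r + 1) f := by
    refine ⟨fun K _ => hf0 K, fun T hT => ?_⟩
    obtain ⟨i, S, hS, hc, rfl⟩ := exists_eq_image hφ hT.isClique (by rw [hT.card_eq]; omega)
    obtain ⟨s, z, s', z', hne, h1, h2⟩ := exists_two_facets ⟨hS, hc.trans hT.card_eq⟩
    have hne' : Q (i, s, z) ≠ Q (i, s', z') := fun h =>
      hne (Finset.image_injective (hφ.injective i) h)
    have hfQ : ∀ x, f (Q x) = 1 / 2 := fun x => by
      simp [f, hQ']
    calc (1 : ℝ) = ∑ K ∈ {Q (i, s, z), Q (i, s', z')}, f K := by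
          rw [Finset.sum_pair hne', hfQ, hfQ]; norm_num
      _ ≤ _ := by
          refine Finset.sum_le_sum_of_subset_of_nonneg ?_ fun K _ _ => hf0 K
          intro K hK
          rw [Finset.mem_insert, Finset.mem_singleton] at hK
          rw [Finset.mem_filter]
          rcases hK with rfl | rfl
          · exact ⟨hQcl _, Finset.image_subset_image h1⟩
          · exact ⟨hQcl _, Finset.image_subset_image h2⟩
  refine (csInf_le (bddBelow_fracCover G _) ⟨f, hf, rfl⟩).trans ?_
  have hcard : (Q'.card : ℝ) ≤ (Fintype.card I * 2 ^ r : ℕ) * 5 := by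
    have : Q'.card ≤ Fintype.card (I × (Fin r → Bool) × Fin 5) := Finset.card_image_le
    rw [Fintype.card_prod, Fintype.card_prod, Fintype.card_fun, Fintype.card_bool,
      Fintype.card_fin, Fintype.card_fin, ← mul_assoc] at this
    exact_mod_cast this
  calc ∑ K ∈ cliques G, f K ≤ ∑ K ∈ Q', f K := by
        simp only [f]
        rw [Finset.sum_ite_mem, Finset.sum_ite_mem, Finset.inter_self]
        exact Finset.sum_le_sum_of_subset_of_nonneg Finset.inter_subset_right
          fun _ _ _ => by norm_num
    _ = Q'.card * (1 / 2) := by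
        simp only [f]
        rw [Finset.sum_ite_mem, Finset.inter_self, Finset.sum_const, nsmul_eq_mul]
    _ ≤ _ := by linarith

/-- It is enough to count the cliques that cover ridges: at least three for each copy and sign
vector, with no clique serving two such pairs. -/
theorem le_coverNum_packGraph (hφ : IsPacking φ) (hr : 1 ≤ r) :
    3 * (Fintype.card I * 2 ^ r) ≤ coverNum (packGraph (pentJoin r) hφ) (r + 1) := by
  classical
  obtain ⟨F, hF, hc⟩ := exists_isCover_card_eq (packGraph (pentJoin r) hφ) (r + 1)
  rw [← hc]
  have hFcl : ∀ K ∈ F, (packGraph (pentJoin r) hφ).IsClique (K : Set V) := fun K hK => by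
    simpa [cliques] using hF.1 hK
  have hex : ∀ (x : I × (Fin r → Bool)) (z : Fin 5), ∃ K ∈ F, (ridge x.2 z).image (φ x.1) ⊆ K :=
    fun x z => hF.2 _ ⟨(isClique_image hφ).2 (isClique_ridge _ _), by
      rw [Finset.card_image_of_injective _ (hφ.injective _), card_ridge]⟩
  choose g hgF hg using hex
  have h1 : ∀ (x : I × (Fin r → Bool)) (z : Fin 5), 1 < (ridge x.2 z).card := fun x z => by
    rw [card_ridge]; omega
  have hthree : ∀ x, 3 ≤ (Finset.univ.image (g x)).card := by
    intro x
    -- Ridges covered by one clique have pairwise equal or adjacent pentagon vertices, so fibres of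
    -- `g x` have size at most 2, and five ridges need three cliques.
    have := Finset.card_le_mul_card_image (f := g x) Finset.univ 2 (by
      intro K hK
      apply card_le_two_of_pentagon_clique
      intro a ha b hb
      rw [Finset.mem_filter] at ha hb
      by_cases hab : a = b
      · exact .inl hab
      refine .inr (pentJoin_adj_inl.1 ((packGraph_adj_apply hφ (i := x.1)).1 ?_))
      refine hFcl (g x a) (hgF x a) ?_ ?_ ((hφ.injective _).ne (by simpa using hab))
      · exact hg x a (Finset.mem_image_of_mem _ (inl_mem_ridge.2 rfl))
      · have := hg x b (Finset.mem_image_of_mem _ (inl_mem_ridge.2 rfl))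
        rw [hb.2, ← ha.2] at this
        exact this)
    rw [Finset.card_fin] at this
    omega
  have hdisj : ∀ x y z w, g x z = g y w → x = y := by
    rintro ⟨i, s⟩ ⟨j, s'⟩ z w h
    have hy := hg (j, s') w
    rw [← h] at hy
    have hx := hg (i, s) z
    have hcl := hFcl _ (hgF (i, s) z)
    obtain rfl : i = j := index_eq_of_image_subset hφ hcl (h1 (i, s) z) (h1 (j, s') w) hx hy
    refine Prod.ext rfl (funext fun l => ?_)
    by_contra hl
    have hadj : (pentJoin r).Adj (.inr (l, s l)) (.inr (l, s' l)) :=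
      (packGraph_adj_apply hφ (i := i)).1 <| hcl
        (hx (Finset.mem_image_of_mem _ (inr_mem_ridge.2 rfl)))
        (hy (Finset.mem_image_of_mem _ (inr_mem_ridge.2 rfl)))
        ((hφ.injective _).ne (by simpa using hl))
    exact hadj rfl
  calc 3 * (Fintype.card I * 2 ^ r)
      = ∑ _x : I × (Fin r → Bool), 3 := by simp [mul_comm]
    _ ≤ ∑ x, (Finset.univ.image (g x)).card := Finset.sum_le_sum fun x _ => hthree x
    _ = (Finset.univ.biUnion fun x => Finset.univ.image (g x)).card := by
        rw [Finset.card_biUnion]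
        intro x _ y _ hxy
        rw [Function.onFun, Finset.disjoint_left]
        intro K hx hy
        rw [Finset.mem_image] at hx hy
        obtain ⟨z, -, rfl⟩ := hx
        obtain ⟨w, -, h⟩ := hy
        exact hxy (hdisj x y z w h.symm)
    _ ≤ F.card := Finset.card_le_card <| by
        intro K hK
        simp only [Finset.mem_biUnion, Finset.mem_image, Finset.mem_univ, true_and] at hK
        obtain ⟨x, z, rfl⟩ := hK
        exact hgF x z

/-- The gap of a packing of pentagon joins is at least the number of copies. -/
theorem card_le_gap_packGraph (hφ : IsPacking φ) (hr : 1 ≤ r) :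
    (Fintype.card I : ℝ) ≤ coverNum (packGraph (pentJoin r) hφ) (r + 1) -
      fracCoverNum (packGraph (pentJoin r) hφ) (r + 1) := by
  have h1 := fracCoverNum_packGraph_le hφ hr
  have h2 : (3 * (Fintype.card I * 2 ^ r : ℕ) : ℝ) ≤
      coverNum (packGraph (pentJoin r) hφ) (r + 1) := by
    exact_mod_cast le_coverNum_packGraph hφ hr
  have h3 : (Fintype.card I : ℝ) * 2 ≤ (Fintype.card I * 2 ^ r : ℕ) := by
    have : Fintype.card I * 2 ^ 1 ≤ Fintype.card I * 2 ^ r := by gcongr; norm_num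
    exact_mod_cast this
  linarith

end Gap

/-! ### Packing copies by points of a sphere -/

/-- If `α a + β b + γ c = 0` with `α + β + γ = 0` and `α, β ≠ 0`, and `a`, `b`, `c` have the same
Euclidean norm, then `a = b`. -/
theorem eq_of_affine_relation_of_sum_sq_eq {d : ℕ} {a b c : Fin d → ℤ} {α β γ k : ℤ} (hα : α ≠ 0)
    (hβ : β ≠ 0) (hsum : α + β + γ = 0) (h : ∀ l, α * a l + β * b l + γ * c l = 0)
    (ha : ∑ l, a l ^ 2 = k) (hb : ∑ l, b l ^ 2 = k) (hc : ∑ l, c l ^ 2 = k) : a = b := by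
  -- Strict convexity in algebraic form: summed over coordinates, the right side of `h1` is `(α +
  -- β)² k - (α + β)² k`.
  have h0 : α * β * ∑ l, (a l - b l) ^ 2 = 0 := by
    have h1 : ∀ l, α * β * (a l - b l) ^ 2 =
        (α + β) * (α * a l ^ 2 + β * b l ^ 2) - (α + β) ^ 2 * c l ^ 2 := by
      intro l
      have hγ : γ = -(α + β) := by linarith
      have h2 : (α + β) * c l = α * a l + β * b l := by
        have := h l
        rw [hγ] at this
        linarith
      rw [← mul_pow, h2]
      ring
    rw [Finset.mul_sum, Finset.sum_congr rfl fun l _ => h1 l, Finset.sum_sub_distrib,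
      ← Finset.mul_sum, ← Finset.mul_sum, Finset.sum_add_distrib, ← Finset.mul_sum,
      ← Finset.mul_sum, ha, hb, hc]
    ring
  rw [mul_eq_zero, or_iff_right (mul_ne_zero hα hβ),
    Finset.sum_eq_zero_iff_of_nonneg fun _ _ => sq_nonneg _] at h0
  funext l
  exact sub_eq_zero.1 (pow_eq_zero_iff two_ne_zero |>.1 (h0 l (Finset.mem_univ l)))

section Sphere

variable {U : Type*} [Fintype U] {d m k : ℕ}

/-- The translate by `x` of a multiple of `a` by the label of a vertex, as a point of a box. -/
def spherePoint (c : U ≃ Fin (Fintype.card U))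
    (i : (Fin d → Fin m) × Behrend.sphere d m k) (u : U) : U × (Fin d → Fin (Fintype.card U * m)) :=
  (u, fun l => ⟨i.1 l + c u * i.2.1 l, by
    have h1 := (i.1 l).2
    have h2 := Behrend.mem_box.1 (Behrend.sphere_subset_box i.2.2) l
    have h3 := (c u).2
    calc (i.1 l : ℕ) + c u * i.2.1 l < m + c u * m := by
          have := Nat.mul_le_mul_left (c u : ℕ) h2.le
          omega
      _ = (c u + 1) * m := by ring
      _ ≤ _ := Nat.mul_le_mul_right _ h3⟩)

theorem spherePoint_apply_eq {c : U ≃ Fin (Fintype.card U)}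
    {i j : (Fin d → Fin m) × Behrend.sphere d m k} {u : U}
    (h : spherePoint c i u = spherePoint c j u) (l : Fin d) :
    ((i.1 l : ℕ) : ℤ) + (c u : ℕ) * i.2.1 l = ((j.1 l : ℕ) : ℤ) + (c u : ℕ) * j.2.1 l := by
  have := congrArg Fin.val (congrFun (congrArg Prod.snd h) l)
  exact_mod_cast this

theorem index_eq_of_sphere_eq {c : U ≃ Fin (Fintype.card U)}
    {i j : (Fin d → Fin m) × Behrend.sphere d m k} {u : U}
    (h : spherePoint c i u = spherePoint c j u) (h2 : ∀ l, (i.2.1 l : ℤ) = j.2.1 l) : i = j := by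
  refine Prod.ext (funext fun l => Fin.ext ?_)
    (Subtype.ext (funext fun l => by exact_mod_cast h2 l))
  have := spherePoint_apply_eq h l
  rw [h2 l] at this
  exact_mod_cast add_right_cancel this

theorem label_sub_ne_zero (c : U ≃ Fin (Fintype.card U)) {u v : U} (h : u ≠ v) :
    ((c u : ℕ) : ℤ) - (c v : ℕ) ≠ 0 := fun h0 =>
  h (c.injective (Fin.ext (by exact_mod_cast sub_eq_zero.1 h0)))

/-- Two common vertices determine the direction, hence the translate. In a triangle the translates
cancel, leaving an affine relation between three sphere points. -/
theorem isPacking_spherePoint (c : U ≃ Fin (Fintype.card U)) :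
    IsPacking (spherePoint (d := d) (m := m) (k := k) c) where
  eq_of_apply_eq h := congrArg Prod.fst h
  eq_of_pair {i j u v} huv hu hv := by
    refine index_eq_of_sphere_eq hu fun l => ?_
    have h1 := spherePoint_apply_eq hu l
    have h2 := spherePoint_apply_eq hv l
    refine mul_left_cancel₀ (label_sub_ne_zero c huv) ?_
    linarith
  eq_of_triangle {i j k' u v w} huv hvw huw hu hv hw := by
    have hk : ∀ i : (Fin d → Fin m) × Behrend.sphere d m k, ∑ l, (i.2.1 l : ℤ) ^ 2 = k := by
      intro i
      exact_mod_cast (Finset.mem_filter.1 i.2.2).2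
    have key := eq_of_affine_relation_of_sum_sq_eq (a := fun l => (i.2.1 l : ℤ))
      (b := fun l => (j.2.1 l : ℤ)) (c := fun l => (k'.2.1 l : ℤ)) (label_sub_ne_zero c huv)
      (label_sub_ne_zero c hvw) (γ := ((c w : ℕ) : ℤ) - (c u : ℕ)) (by ring) (fun l => by
        have h1 := spherePoint_apply_eq hu l
        have h2 := spherePoint_apply_eq hv l
        have h3 := spherePoint_apply_eq hw l
        linarith) (hk i) (hk j) (hk k')
    exact index_eq_of_sphere_eq hv (congrFun key)

end Sphere

theorem IsPacking.comp {I U V W : Type*} {φ : I → U → V} (hφ : IsPacking φ) {e : V → W}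
    (he : Function.Injective e) : IsPacking fun i u => e (φ i u) where
  eq_of_apply_eq h := hφ.eq_of_apply_eq (he h)
  eq_of_pair huv hu hv := hφ.eq_of_pair huv (he hu) (he hv)
  eq_of_triangle huv hvw huw hu hv hw := hφ.eq_of_triangle huv hvw huw (he hu) (he hv) (he hw)

/-- A graph on `n` vertices whose gap is at least the number of copies in a sphere packing. -/
theorem exists_gap_of_sphere {t : ℕ} (ht : 2 ≤ t) {d m k n : ℕ}
    (hn : (2 * t + 3) * ((2 * t + 3) * m) ^ d ≤ n) :
    ∃ G : SimpleGraph (Fin n),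
      ((m ^ d * (Behrend.sphere d m k).card : ℕ) : ℝ) ≤ coverNum G t - fracCoverNum G t := by
  obtain ⟨r, rfl⟩ : ∃ r, t = r + 1 := ⟨t - 1, by omega⟩
  have hU : Fintype.card (PentVertex r) = 2 * (r + 1) + 3 := by
    simp only [Fintype.card_sum, Fintype.card_fin, Fintype.card_prod, Fintype.card_bool]
    ring
  have hcard : Fintype.card (PentVertex r × (Fin d → Fin (Fintype.card (PentVertex r) * m))) ≤
      Fintype.card (Fin n) := by
    rw [Fintype.card_prod, Fintype.card_fun, Fintype.card_fin, Fintype.card_fin, Fintype.card_fin,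
      hU]
    exact hn
  obtain ⟨e⟩ := Function.Embedding.nonempty_of_card_le hcard
  have hφ := (isPacking_spherePoint (d := d) (m := m) (k := k)
    (Fintype.equivFin (PentVertex r))).comp e.injective
  refine ⟨packGraph (pentJoin r) hφ, ?_⟩
  have := card_le_gap_packGraph hφ (by omega)
  rw [Fintype.card_prod, Fintype.card_fun, Fintype.card_fin, Fintype.card_fin,
    Fintype.card_coe] at this
  exact this

/-- In dimension 0 the sphere of radius 0 is one point, so the packing is a single copy. -/
theorem exists_one_le_gap {t : ℕ} (ht : 2 ≤ t) {n : ℕ} (hn : 2 * t + 3 ≤ n) :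
    ∃ G : SimpleGraph (Fin n), (1 : ℝ) ≤ coverNum G t - fracCoverNum G t := by
  obtain ⟨G, hG⟩ := exists_gap_of_sphere ht (d := 0) (m := 0) (k := 0) (n := n) (by simpa using hn)
  refine ⟨G, le_trans ?_ hG⟩
  simp [Behrend.sphere, Behrend.box]

theorem exists_large_gap {t : ℕ} (ht : 2 ≤ t) {d m n : ℕ}
    (hn : (2 * t + 3) * ((2 * t + 3) * m) ^ d ≤ n) :
    ∃ G : SimpleGraph (Fin n),
      (m : ℝ) ^ d * ((m : ℝ) ^ d / (d * (m : ℝ) ^ 2)) ≤ coverNum G t - fracCoverNum G t := by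
  obtain ⟨k, hk⟩ := Behrend.exists_large_sphere d m
  obtain ⟨G, hG⟩ := exists_gap_of_sphere ht (k := k) hn
  refine ⟨G, le_trans ?_ hG⟩
  push_cast at hk ⊢
  gcongr

/-! ### Choice of dimension and side length -/

/-- The lower bound for the gap, without its constant. -/
noncomputable def gapBound (n : ℕ) : ℝ :=
  Real.log (Real.log (n : ℝ)) /
    (Real.log (n : ℝ)) ^ (8 * Real.sqrt (Real.log (n : ℝ) / Real.log (Real.log (n : ℝ)))) *
    (n : ℝ) ^ 2

theorem rpow_mul_sqrt_div_log {L : ℝ} (hL : 1 < L) (a : ℝ) :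
    L ^ (a * √(L / Real.log L)) = Real.exp (a * (√L * √(Real.log L))) := by
  have h1 : 0 < Real.log L := Real.log_pos hL
  rw [Real.rpow_def_of_pos (by linarith), Real.sqrt_div (by linarith)]
  congr 1
  have h2 : √(Real.log L) ≠ 0 := (Real.sqrt_pos.2 h1).ne'
  field_simp
  rw [Real.sq_sqrt h1.le, mul_comm]

theorem tendsto_log_natCast : Tendsto (fun n : ℕ => Real.log (n : ℝ)) atTop atTop :=
  Real.tendsto_log_atTop.comp tendsto_natCast_atTop_atTop

/-- A dimension and a side length for which the sphere packing attains the required bound. -/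
theorem eventually_exists_parameters (h : ℕ) (hh : 1 ≤ h) :
    ∀ᶠ n : ℕ in atTop, ∃ d m : ℕ, h * (h * m) ^ d ≤ n ∧
      gapBound n ≤ (m : ℝ) ^ d * ((m : ℝ) ^ d / (d * (m : ℝ) ^ 2)) := by
  set K : ℝ := (h : ℝ) ^ 2 with hK
  have hh' : (1 : ℝ) ≤ h := by exact_mod_cast hh
  have hK1 : 1 ≤ K := one_le_pow₀ hh'
  -- `B * s` is the total exponent lost, collected in `hmain`; the target allows `8 * s * √(log L)`,
  -- which is eventually larger.
  set B : ℝ := 4 * Real.log (2 * K) + 6 with hB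
  have e1 : ∀ᶠ L : ℝ in atTop, B / 8 ≤ √(Real.log L) :=
    (Real.tendsto_sqrt_atTop.comp Real.tendsto_log_atTop).eventually_ge_atTop _
  have e2 : ∀ᶠ L : ℝ in atTop, 2 * Real.log (2 * K) ≤ √L :=
    Real.tendsto_sqrt_atTop.eventually_ge_atTop _
  filter_upwards [tendsto_log_natCast.eventually (e1.and (e2.and (eventually_gt_atTop 1)))]
    with n ⟨hn1, hn2, hL⟩
  set L := Real.log (n : ℝ) with hLdef
  set s := √L with hs
  have hs1 : 1 ≤ s := Real.one_le_sqrt.2 hL.le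
  have hsq : s * s = L := Real.mul_self_sqrt (by linarith)
  have hn0 : (0 : ℝ) < n := by
    rcases Nat.eq_zero_or_pos n with rfl | h
    · simp [hLdef] at hL; linarith
    · exact_mod_cast h
  have hexpL : Real.exp L = n := Real.exp_log hn0
  -- This balances the loss `(2 * K) ^ (2 * d)` against `m ^ 2`, where `m` is about `exp (L / d)`:
  -- both are `exp (O(s))`.
  set d := ⌈s⌉₊ with hd
  have hds : s ≤ d := Nat.le_ceil s
  have hd2 : (d : ℝ) ≤ 2 * s := by
    have := Nat.ceil_lt_add_one (a := s) (by linarith)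
    linarith
  have hd0 : (0 : ℝ) < d := by linarith
  have hdn : d ≠ 0 := by rintro h0; rw [h0] at hd0; simp at hd0
  set y := Real.exp (L / d) with hy
  have hyd : y ^ d = n := by
    rw [hy, ← Real.exp_nat_mul, mul_div_cancel₀ _ hd0.ne', hexpL]
  have hyK : 2 * K ≤ y := by
    rw [← Real.exp_log (show 0 < 2 * K by linarith), hy]
    refine Real.exp_le_exp.2 ?_
    rw [le_div_iff₀ hd0]
    have hlog : 0 ≤ Real.log (2 * K) := Real.log_nonneg (by linarith)
    nlinarith
  have hys : y ≤ Real.exp s := by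
    refine Real.exp_le_exp.2 ?_
    rw [div_le_iff₀ hd0]
    nlinarith
  -- Dividing by `K = h ^ 2` absorbs `h * h ^ d ≤ K ^ d`; as `y / K ≥ 2`, the floor costs at most a
  -- factor 2.
  set m := ⌊y / K⌋₊ with hm
  have hK0 : 0 < K := by linarith
  have hmy : (m : ℝ) ≤ y / K := Nat.floor_le (by positivity)
  have hym : y / (2 * K) ≤ m := by
    have h1 : y / K < m + 1 := Nat.lt_floor_add_one _
    have h2 : 2 ≤ y / K := by rw [le_div_iff₀ hK0]; exact hyK
    have h3 : y / (2 * K) = y / K / 2 := by field_simp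
    linarith
  have hm0 : (0 : ℝ) < m := lt_of_lt_of_le (by positivity) hym
  refine ⟨d, m, ?_, ?_⟩
  · have : (h : ℝ) * (h * m) ^ d ≤ n := by
      calc (h : ℝ) * (h * m) ^ d ≤ (h : ℝ) ^ d * (h * m) ^ d := by
            gcongr; exact le_self_pow₀ hh' hdn
        _ = (K * m) ^ d := by rw [← mul_pow, hK]; ring
        _ ≤ y ^ d := by
            gcongr
            rw [le_div_iff₀ hK0] at hmy
            linarith
        _ = n := hyd
    exact_mod_cast this
  · have hlogL : 0 < Real.log L := Real.log_pos hL
    have hnum : (n : ℝ) / (2 * K) ^ d ≤ (m : ℝ) ^ d := by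
      rw [← hyd, ← div_pow]
      gcongr
    have hms : (m : ℝ) ≤ Real.exp s := hmy.trans ((div_le_self (by positivity) hK1).trans hys)
    have hden : (d : ℝ) * (m : ℝ) ^ 2 ≤ Real.exp (4 * s) := by
      have : (d : ℝ) ≤ Real.exp (2 * s) := by
        have := Real.add_one_le_exp (2 * s)
        linarith
      calc (d : ℝ) * (m : ℝ) ^ 2 ≤ Real.exp (2 * s) * Real.exp s ^ 2 := by gcongr
        _ = Real.exp (4 * s) := by rw [← Real.exp_nat_mul, ← Real.exp_add]; push_cast; ring_nf
    have hpow : (2 * K) ^ d ≤ Real.exp (Real.log (2 * K) * (2 * s)) := by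
      rw [← Real.exp_log (show 0 < 2 * K by linarith), ← Real.exp_nat_mul, Real.log_exp]
      refine Real.exp_le_exp.2 ?_
      rw [mul_comm]
      have hlog : 0 ≤ Real.log (2 * K) := Real.log_nonneg (by linarith)
      gcongr
    have hloglog : Real.log L ≤ Real.exp (2 * s) := by
      rw [← hsq, Real.log_mul (by linarith) (by linarith)]
      have h1 := Real.log_le_sub_one_of_pos (show 0 < s by linarith)
      have h2 := Real.add_one_le_exp (2 * s)
      linarith
    have hmain : Real.log L * ((2 * K) ^ d * (2 * K) ^ d * (d * (m : ℝ) ^ 2)) ≤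
        Real.exp (8 * (s * √(Real.log L))) := by
      calc Real.log L * ((2 * K) ^ d * (2 * K) ^ d * (d * (m : ℝ) ^ 2))
          ≤ Real.exp (2 * s) * (Real.exp (Real.log (2 * K) * (2 * s)) *
            Real.exp (Real.log (2 * K) * (2 * s)) * Real.exp (4 * s)) := by gcongr
        _ = Real.exp (B * s) := by
            rw [← Real.exp_add, ← Real.exp_add, ← Real.exp_add, hB]; ring_nf
        _ ≤ _ := Real.exp_le_exp.2 (by nlinarith)
    have hP : 0 < (2 * K) ^ d * (2 * K) ^ d * (d * (m : ℝ) ^ 2) := by positivity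
    calc gapBound n = Real.log L / Real.exp (8 * (s * √(Real.log L))) * (n : ℝ) ^ 2 := by
          rw [gapBound, rpow_mul_sqrt_div_log hL]
      _ ≤ 1 / ((2 * K) ^ d * (2 * K) ^ d * (d * (m : ℝ) ^ 2)) * (n : ℝ) ^ 2 := by
          gcongr ?_ * _
          rw [div_le_div_iff₀ (Real.exp_pos _) hP, one_mul]
          exact hmain
      _ = (n : ℝ) / (2 * K) ^ d * ((n : ℝ) / (2 * K) ^ d / (d * (m : ℝ) ^ 2)) := by
          field_simp
      _ ≤ _ := by gcongr

/-! ### The exponent `2 - o(1)` -/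

theorem tendsto_log_div_self : Tendsto (fun L : ℝ => Real.log L / L) atTop (𝓝 0) := by
  simpa using Real.tendsto_pow_log_div_mul_add_atTop 1 0 1 one_ne_zero

theorem tendsto_log_gapFactor_div {c : ℝ} :
    Tendsto (fun L : ℝ => (Real.log c + Real.log (Real.log L) - 8 * (√L * √(Real.log L))) / L)
      atTop (𝓝 0) := by
  have h1 : Tendsto (fun L : ℝ => Real.log c / L) atTop (𝓝 0) :=
    tendsto_const_nhds.div_atTop tendsto_id
  have h2 : Tendsto (fun L : ℝ => Real.log (Real.log L) / L) atTop (𝓝 0) := by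
    have h := (tendsto_log_div_self.comp Real.tendsto_log_atTop).mul tendsto_log_div_self
    rw [mul_zero] at h
    refine h.congr' ?_
    filter_upwards [eventually_gt_atTop 1] with L hL
    have := (Real.log_pos hL).ne'
    simp only [Function.comp]
    field_simp
  have h3 : Tendsto (fun L : ℝ => 8 * (√L * √(Real.log L)) / L) atTop (𝓝 0) := by
    have h := (tendsto_log_div_self.sqrt).const_mul 8
    rw [Real.sqrt_zero, mul_zero] at h
    refine h.congr' ?_
    filter_upwards [eventually_gt_atTop 1] with L hL
    have h0 : √L ≠ 0 := (Real.sqrt_pos.2 (by linarith)).ne'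
    rw [Real.sqrt_div (Real.log_nonneg hL.le)]
    field_simp
    rw [Real.sq_sqrt (by linarith)]
  have := (h1.add h2).sub h3
  simp only [add_zero, sub_zero] at this
  refine this.congr fun L => ?_
  ring

/-- The lower bound is `n ^ (2 - o(1))`. -/
theorem exists_gapBound_eq_rpow {c : ℝ} (hc : 0 < c) :
    ∃ ε : ℕ → ℝ, Tendsto ε atTop (𝓝 0) ∧ ∀ n : ℕ, 1 < Real.log (n : ℝ) →
      c * gapBound n = (n : ℝ) ^ ((2 : ℝ) - ε n) := by
  -- This is `ε n` solved from the required equation by taking logarithms.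
  refine ⟨fun n => -((Real.log c + Real.log (Real.log (Real.log (n : ℝ))) -
    8 * (√(Real.log (n : ℝ)) * √(Real.log (Real.log (n : ℝ))))) / Real.log (n : ℝ)), ?_, ?_⟩
  · simpa using (tendsto_log_gapFactor_div.comp tendsto_log_natCast).neg
  · intro n hL
    have hn0 : (0 : ℝ) < n := by
      rcases Nat.eq_zero_or_pos n with rfl | h
      · simp at hL; linarith
      · exact_mod_cast h
    have hlogL := Real.log_pos hL
    rw [gapBound, rpow_mul_sqrt_div_log hL, Real.rpow_def_of_pos hn0, sub_neg_eq_add, mul_add,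
      mul_div_cancel₀ _ (by linarith), Real.exp_add, Real.exp_sub, Real.exp_add, Real.exp_log hc,
      Real.exp_log hlogL, mul_comm (Real.log (n : ℝ)) 2, ← Real.log_rpow hn0,
      Real.exp_log (by positivity), Real.rpow_two]
    ring

theorem gapBound_pos {n : ℕ} (hL : 1 < Real.log (n : ℝ)) : 0 < gapBound n := by
  have h1 := Real.log_pos hL
  have h2 : (n : ℝ) ≠ 0 := by rintro h; rw [h] at hL; simp at hL; linarith
  have h3 : 0 < (Real.log (n : ℝ)) ^
      (8 * Real.sqrt (Real.log (n : ℝ) / Real.log (Real.log (n : ℝ)))) :=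
    Real.rpow_pos_of_pos (by linarith) _
  unfold gapBound
  positivity

/-! ### The constant and the conclusion -/

theorem exists_gapBound_lt_gap {t : ℕ} (ht : 2 ≤ t) :
    ∃ c : ℝ, 0 < c ∧ ∀ n : ℕ, 1 < Real.log (n : ℝ) → 2 * t + 3 ≤ n →
      ∃ G : SimpleGraph (Fin n), c * gapBound n < coverNum G t - fracCoverNum G t := by
  obtain ⟨N, hN⟩ := eventually_atTop.1 (eventually_exists_parameters (2 * t + 3) (by omega))
  have hS : 0 ≤ ∑ k ∈ Finset.range N, |gapBound k| := Finset.sum_nonneg fun _ _ => abs_nonneg _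
  -- The sum makes `c * gapBound n < 1` for all `n < N`; the 2 makes `c < 1`, giving strictness for
  -- `n ≥ N`.
  refine ⟨1 / (2 + ∑ k ∈ Finset.range N, |gapBound k|), by positivity, fun n hL hn => ?_⟩
  rw [one_div_mul_eq_div]
  have hpos := gapBound_pos hL
  rcases lt_or_ge n N with h | h
  · obtain ⟨G, hG⟩ := exists_one_le_gap ht hn
    refine ⟨G, lt_of_lt_of_le ?_ hG⟩
    rw [div_lt_one (by positivity)]
    have h1 := Finset.single_le_sum (f := fun k => |gapBound k|) (fun _ _ => abs_nonneg _)
      (Finset.mem_range.2 h)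
    have h2 := le_abs_self (gapBound n)
    linarith
  · obtain ⟨d, m, h1, h2⟩ := hN n h
    obtain ⟨G, hG⟩ := exists_large_gap ht h1
    exact ⟨G, (div_lt_self hpos (by linarith)).trans_le (h2.trans hG)⟩

end CliqueCover

theorem mainTheorem7 (t : ℕ) (ht : 2 ≤ t) :
    ∃ c : ℝ, 0 < c ∧
      (∀ n : ℕ, Real.exp 4 + (t : ℝ) ≤ (n : ℝ) → 2 * t + 3 ≤ n →
        ∃ G : SimpleGraph (Fin n),
          (CliqueCover.coverNum G t : ℝ) - CliqueCover.fracCoverNum G t >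
            c * Real.log (Real.log (n : ℝ)) /
              (Real.log (n : ℝ)) ^
                (8 * Real.sqrt (Real.log (n : ℝ) / Real.log (Real.log (n : ℝ)))) *
              (n : ℝ) ^ 2) ∧
      ∃ ε : ℕ → ℝ, Tendsto ε atTop (𝓝 0) ∧
        ∀ n : ℕ, Real.exp 4 + (t : ℝ) ≤ (n : ℝ) → 2 * t + 3 ≤ n →
          c * Real.log (Real.log (n : ℝ)) /
              (Real.log (n : ℝ)) ^
                (8 * Real.sqrt (Real.log (n : ℝ) / Real.log (Real.log (n : ℝ)))) *
              (n : ℝ) ^ 2 = (n : ℝ) ^ ((2 : ℝ) - ε n) := by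
  obtain ⟨c, hc, hgap⟩ := CliqueCover.exists_gapBound_lt_gap ht
  obtain ⟨ε, hε, heq⟩ := CliqueCover.exists_gapBound_eq_rpow hc
  have hlog : ∀ n : ℕ, Real.exp 4 + (t : ℝ) ≤ (n : ℝ) → 1 < Real.log (n : ℝ) := by
    intro n hn
    have h1 : Real.exp 4 ≤ n := by linarith [(Nat.cast_nonneg t : (0 : ℝ) ≤ t)]
    have h2 := (Real.le_log_iff_exp_le ((Real.exp_pos 4).trans_le h1)).2 h1
    linarith
  have hbound : ∀ n : ℕ, c * Real.log (Real.log (n : ℝ)) /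
      (Real.log (n : ℝ)) ^ (8 * Real.sqrt (Real.log (n : ℝ) / Real.log (Real.log (n : ℝ)))) *
      (n : ℝ) ^ 2 = c * CliqueCover.gapBound n := by
    intro n
    rw [CliqueCover.gapBound]
    ring
  refine ⟨c, hc, fun n hn hn' => ?_, ε, hε, fun n hn _ => ?_⟩
  · rw [hbound]
    exact hgap n (hlog n hn) hn'
  · rw [hbound]
    exact heq n (hlog n hn)
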